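/- Let $N\ge 1$ and $0\le K,n\le N$ be integers, and let $X\sim\mathrm{Hypergeometric}(N,K,n)$, i.e. $\Pr[X=k]=\binom{K}{k}\binom{N-K}{n-k}/\binom{N}{n}$ for $0\le k\le n$. Let $d$ be an integer with $d\ge nK/N+1$. If $d\le K$, then $$\Pr[X\ge d]\le \exp\left[-K\,\mathrm{D}\left(\tfrac{d}{K}\,\Big\|\,\tfrac{n}{N}\right)\right]\quad\text{and}\quad \Pr[X\ge d]\le I_{n/N}(d,\,K-d+1),$$ and moreover $I_{n/N}(d,K-d+1)=\Pr[B\ge d]$ for $B\sim\mathrm{Binomial}(K,n/N)$. If $d>K$, then $\Pr[X\ge d]=0$. Here, for $x,y\in[0,1]$, $\mathrm{D}(x\,\|\,y)=x\ln\frac{x}{y}+(1-x)\ln\frac{1-x}{1-y}$ is the Kullback–Leibler divergence between the Bernoulli distributions of parameters $x$ and $y$, with the usual conventions that a term with vanishing prefactor is $0$, that $\mathrm{D}(x\,\|\,y)=+\infty$ if $y=0\ne x$ or $y=1\ne x$, and that $\exp(-\infty)=0$; and, for $a,b>0$ and $x\in[0,1]$, $I_x(a,b)=\int_0^x t^{a-1}(1-t)^{b-1}\,dt\Big/\int_0^1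 t^{a-1}(1-t)^{b-1}\,dt$ is the regularized incomplete beta function. -/

import Mathlib

open MeasureTheory ProbabilityTheory
open scoped ENNReal

noncomputable section

/-- The mass at `k` of the hypergeometric distribution: the fraction of the `n`-element subsets of
an `N`-element population that contain exactly `k` of `K` marked elements. The case distinction is
needed because `n - k` is truncated subtraction. -/
def hypergeometricMass (N K n k : ℕ) : ℝ≥0∞ :=
  if k ≤ n then ((K.choose k * (N - K).choose (n - k) : ℕ) : ℝ≥0∞) / (N.choose n : ℝ≥0∞) else 0

theorem hypergeometricMass_sum (N K n : ℕ) (hK : K ≤ N) (hn : n ≤ N) :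
    ∑ k ∈ Finset.range (n + 1), hypergeometricMass N K n k = 1 := by
  have h1 : ∑ k ∈ Finset.range (n + 1), hypergeometricMass N K n k =
      ∑ k ∈ Finset.range (n + 1),
        ((K.choose k * (N - K).choose (n - k) : ℕ) : ℝ≥0∞) / (N.choose n : ℝ≥0∞) := by
    refine Finset.sum_congr rfl fun k hk => ?_
    rw [hypergeometricMass, if_pos (Nat.lt_succ_iff.1 (Finset.mem_range.1 hk))]
  have h2 : ∑ k ∈ Finset.range (n + 1), K.choose k * (N - K).choose (n - k) = N.choose n := by
    have h := Nat.add_choose_eq K (N - K) n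
    rw [Nat.add_sub_cancel' hK, Finset.Nat.sum_antidiagonal_eq_sum_range_succ_mk] at h
    exact h.symm
  rw [h1]
  simp only [div_eq_mul_inv]
  rw [← Finset.sum_mul, ← Nat.cast_sum, h2]
  exact ENNReal.mul_inv_cancel (Nat.cast_ne_zero.2 (Nat.choose_pos hn).ne')
    (ENNReal.natCast_ne_top _)

/-- The distribution `Hypergeometric(N, K, n)`: the number of marked elements in a sample of size
`n` drawn without replacement from a population of size `N` with `K` marked elements. -/
def hypergeometricPMF (N K n : ℕ) (hK : K ≤ N) (hn : n ≤ N) : PMF ℕ :=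
  PMF.ofFinset (hypergeometricMass N K n) (Finset.range (n + 1))
    (hypergeometricMass_sum N K n hK hn) (fun k hk => by
      rw [hypergeometricMass, if_neg]
      exact fun h => hk (Finset.mem_range.2 (Nat.lt_succ_of_le h)))

/-- The Kullback-Leibler divergence between the Bernoulli distributions of parameters
`x, y ∈ [0, 1]`. It is `⊤` when the first is not absolutely continuous with respect to the second;
otherwise the formula applies, with `0 * log 0 = 0` and `0 * log (0 / 0) = 0`. -/
def bernoulliKL (x y : ℝ) : EReal :=
  open Classical in
  if (y = 0 ∧ x ≠ 0) ∨ (y = 1 ∧ x ≠ 1) then ⊤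
  else ((x * Real.log (x / y) + (1 - x) * Real.log ((1 - x) / (1 - y)) : ℝ) : EReal)

/-- The regularized incomplete beta function `I_x(a, b)`, for `0 ≤ x ≤ 1` and `a, b > 0`. -/
def regIncompleteBeta (x a b : ℝ) : ℝ :=
  (∫ t in (0 : ℝ)..x, t ^ (a - 1) * (1 - t) ^ (b - 1)) /
    ∫ t in (0 : ℝ)..1, t ^ (a - 1) * (1 - t) ^ (b - 1)

end

/-!
# Tail bounds for the hypergeometric distribution by way of the binomial distribution

Exchanging the roles of marked and sampled elements, `X` counts the marked elements among `K` draws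
without replacement from a population of `N` elements, `n` of them marked. Put `p = n / N`. The core
is that the upper tail of `X` is at most that of the binomial variable `B` with parameters `K` and
`p`, at every `d ≥ K * p + 1`. Given this, the entropy bound is Chernoff's bound for `B`
(`binomial_tail_mul_le`), and the incomplete beta function equals the tail of `B` because both have
the same derivative in `p` up to a constant (`regIncompleteBeta_eq`).

For the comparison (`choose_mul_binomialLower_le`), interpolate between `X` and `B` by making `i`
draws without replacement and the other `K - i` with replacement. Let `A` be the number of marked
elements among the first `i` draws, and `B'` the number among `m = K - i - 1` draws with
replacement. If the remaining draw is made without replacement instead of with it, its chance of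
being marked changes from `p` to `(n - A) / (N - i) = p + (i * p - A) / (N - i)`, and this
matters only when `A + B' = s`, where `s = d - 1`. So each step has the right sign as soon as the
conditional mean of `A`, given `A + B' = s`, is at least `i * p`
(`sum_hypergeometricWeight_mul_binomialMass_nonneg`).

That conditional mean is bounded by Stein's method. The conditional weights
`ω a = P(A = a) * P(B' = s - a)` form a birth-death chain with explicit rational step ratios, and
summing detailed balance over its edges, with test function `1 / (N - n - i + a)`, shows that a
drift `f`, a rational function of `a` with denominator `N - n - i + 1 + a`, has nonpositive mean
under `ω`. The drift lies above its tangent line at `a = i * p`, which has negative slope `-C` and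
a nonnegative value there (`exists_stein_drift_ge`), so `0 ≥ E[f] ≥ C * (i * p - E[a])`. The tangent
line bound needs `(1 - p) * (m + 1) > 1`; otherwise every `a` in the support of `ω` is at least
`i * p` already.
-/

/-! ### Hypergeometric and binomial weights -/

/-- The number of `n`-element subsets of an `N`-element population that contain exactly `a` of `i`
marked elements, as a real number. The same number, divided by `N.choose n`, is the probability that
`i` draws without replacement from `N` elements, `n` of them marked, yield `a` marked ones; the
comments below speak of it in this way. The case distinction is needed because `n - a` is truncated
subtraction. -/
def hypergeometricWeight (N n i a : ℕ) : ℝ :=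
  if a ≤ n then (i.choose a : ℝ) * ((N - i).choose (n - a) : ℝ) else 0

/-- The mass at `k` of the binomial distribution with `m` trials and success probability `p`. -/
def binomialMass (p : ℝ) (m k : ℕ) : ℝ := (m.choose k : ℝ) * p ^ k * (1 - p) ^ (m - k)

theorem hypergeometricWeight_nonneg (N n i a : ℕ) : 0 ≤ hypergeometricWeight N n i a := by
  unfold hypergeometricWeight; split_ifs <;> positivity

theorem binomialMass_nonneg {p : ℝ} (hp0 : 0 ≤ p) (hp1 : p ≤ 1) (m k : ℕ) :
    0 ≤ binomialMass p m k := by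
  have : 0 ≤ 1 - p := by linarith
  unfold binomialMass; positivity

theorem binomialMass_eq_zero {p : ℝ} {m k : ℕ} (h : m < k) : binomialMass p m k = 0 := by
  simp [binomialMass, Nat.choose_eq_zero_of_lt h]

theorem cast_succ_mul_choose_succ (M k : ℕ) :
    ((k : ℝ) + 1) * (M.choose (k + 1) : ℝ) = ((M : ℝ) - k) * (M.choose k : ℝ) := by
  rcases le_or_gt k M with h | h
  · have h1 := Nat.choose_succ_right_eq M k
    have h2 : ((M.choose (k + 1) * (k + 1) : ℕ) : ℝ) = ((M.choose k * (M - k) : ℕ) : ℝ) := by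
      rw [h1]
    push_cast [Nat.cast_sub h] at h2
    linarith
  · simp [Nat.choose_eq_zero_of_lt h, Nat.choose_eq_zero_of_lt (Nat.lt_succ_of_lt h)]

/-- The detailed-balance ratio of consecutive binomial masses, in a form free of division. -/
theorem binomialMass_step (p : ℝ) (m b : ℕ) :
    (1 - p) * ((b : ℝ) + 1) * binomialMass p m (b + 1) = p * ((m : ℝ) - b) * binomialMass p m b := by
  have h := cast_succ_mul_choose_succ m b
  unfold binomialMass
  rcases lt_or_ge b m with hb | hb
  · obtain ⟨c, rfl⟩ := Nat.exists_eq_add_of_lt hb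
    rw [show b + c + 1 - (b + 1) = c by omega, show b + c + 1 - b = c + 1 by omega]
    linear_combination (1 - p) * p ^ (b + 1) * (1 - p) ^ c * h
  · rw [Nat.choose_eq_zero_of_lt (Nat.lt_succ_of_le hb)] at h ⊢
    linear_combination p * p ^ b * (1 - p) ^ (m - b) * h

/-- The detailed-balance ratio of consecutive hypergeometric weights, in a form free of division. -/
theorem hypergeometricWeight_step {N i : ℕ} (hi : i ≤ N) (n a : ℕ) :
    ((a : ℝ) + 1) * ((N : ℝ) - i - n + a + 1) * hypergeometricWeight N n i (a + 1) =
      ((i : ℝ) - a) * ((n : ℝ) - a) * hypergeometricWeight N n i a := by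
  unfold hypergeometricWeight
  rcases lt_trichotomy a n with ha | rfl | ha
  · obtain ⟨c, rfl⟩ := Nat.exists_eq_add_of_lt ha
    rw [if_pos (by omega), if_pos (by omega), show a + c + 1 - (a + 1) = c by omega,
      show a + c + 1 - a = c + 1 by omega]
    have h1 := cast_succ_mul_choose_succ i a
    have h2 := cast_succ_mul_choose_succ (N - i) c
    rw [Nat.cast_sub hi] at h2
    push_cast
    linear_combination ((N : ℝ) - i - c) * ((N - i).choose c : ℝ) * h1
      - ((i : ℝ) - a) * (i.choose a : ℝ) * h2
  · simp
  · rw [if_neg (by omega), if_neg (by omega)]; simp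

/-! ### The conditional mean of the draws without replacement -/

/-- The right-hand side is the drift of the Stein identity used in
`sum_hypergeometricWeight_mul_binomialMass_nonneg`. It lies above its tangent line at the mean
`a = i * p`; that line is decreasing with slope `-C` and is nonnegative at the mean. The proof
writes `a = i * p + v`, `s = i * p + t`, `w = i * (1 - p)` and `R = (1 - p) * (N - i) + 1`. -/
theorem exists_stein_drift_ge {N p i m s : ℝ} (hp0 : 0 < p) (hp1 : p < 1) (hi : 0 ≤ i)
    (hm : 1 ≤ m) (hN : i + m + 1 ≤ N) (hq : 1 < (1 - p) * (m + 1))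
    (hs : (i + m + 1) * p ≤ s) (hs' : s ≤ i + m) :
    ∃ C : ℝ, 0 < C ∧ ∀ a : ℝ, a ≤ i → 0 < N - N * p - i + 1 + a →
      C * (i * p - a) ≤
        (1 - p) * (N * p - a) * (i - a) * (s - a) / (N - N * p - i + 1 + a)
          - a * p * (m - s + a) := by
  obtain ⟨t, rfl⟩ : ∃ t, s = i * p + t := ⟨s - i * p, by ring⟩
  obtain ⟨R, hR⟩ : ∃ R, R = (1 - p) * (N - i) + 1 := ⟨_, rfl⟩
  obtain ⟨w, hw⟩ : ∃ w, w = i * (1 - p) := ⟨_, rfl⟩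
  have hw0 : 0 ≤ w := by rw [hw]; exact mul_nonneg hi (by linarith)
  have hRq : 1 + (1 - p) * (m + 1) ≤ R := by nlinarith
  -- this bound is what the condition `hq` is for
  have hR2 : 2 < R := by linarith
  have ht : (m + 1) * p ≤ t := by linarith
  have ht' : t ≤ w + m := by rw [hw]; linarith
  have ht0 : 0 ≤ t := by nlinarith
  have hwt : 0 ≤ w * t := mul_nonneg hw0 ht0
  -- `C` is minus the derivative of the drift at the mean
  refine ⟨p * (i + m) + w * t / R - p * (w + t) / R - p * (w * t) / R ^ 2, ?_, ?_⟩
  · have h1 : p * (w * t) / R ^ 2 ≤ w * t / R := by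
      rw [div_le_div_iff₀ (by positivity) (by positivity)]
      nlinarith [mul_nonneg hwt (by linarith : 0 ≤ R),
        mul_nonneg (mul_nonneg hwt (by linarith : 0 ≤ R)) (by linarith : 0 ≤ R - p)]
    have h2 : p * (w + t) / R < p * (i + m) := by
      rw [div_lt_iff₀ (by linarith), mul_assoc]
      refine mul_lt_mul_of_pos_left ?_ hp0
      have : w ≤ i := by rw [hw]; nlinarith
      nlinarith
    linarith
  · intro a ha hMa
    obtain ⟨v, rfl⟩ : ∃ v, a = i * p + v := ⟨a - i * p, by ring⟩
    have hRv : N - N * p - i + 1 + (i * p + v) = R + v := by rw [hR]; ring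
    rw [hRv] at hMa ⊢
    have hv : v ≤ w := by rw [hw]; linarith
    -- the value of the drift at `v = 0` is nonnegative
    have h0 : 0 ≤ p * i * (t - m * p) - p * (w * t) / R := by
      have h1 : w * t / R ≤ i * (t - m * p) := by
        rw [div_le_iff₀ (by linarith), hw]
        have : (1 - p) * t ≤ (t - m * p) * R := by
          nlinarith [mul_nonneg (by linarith : 0 ≤ t - (m + 1) * p)
              (by linarith : 0 ≤ R - (1 - p)),
            mul_nonneg hp0.le (by linarith : 0 ≤ R - (1 - p) * (m + 1))]
        nlinarith
      have h2 := mul_le_mul_of_nonneg_left h1 hp0.le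
      rw [mul_div_assoc]; linarith
    -- the remainder after the tangent line is nonnegative
    have h3 : R ^ 2 ≤ (R + t) * (R - p) := by
      have : R ≤ (m + 1) * (R - p) := by nlinarith
      nlinarith
    have h4 : 0 ≤ v ^ 2 * ((R + w) * ((R + t) * (R - p)) / (R ^ 2 * (R + v)) - 1) := by
      refine mul_nonneg (sq_nonneg v) (sub_nonneg.2 ?_)
      rw [one_le_div (by positivity), mul_comm (R ^ 2)]
      exact mul_le_mul (by linarith) h3 (by positivity) (by linarith)
    have key : (1 - p) * (N * p - (i * p + v)) * (i - (i * p + v)) * (i * p + t - (i * p + v))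
          / (R + v) - (i * p + v) * p * (m - (i * p + t) + (i * p + v)) =
        (p * i * (t - m * p) - p * (w * t) / R) - (p * (i + m) + w * t / R - p * (w + t) / R
          - p * (w * t) / R ^ 2) * v
          + v ^ 2 * ((R + w) * ((R + t) * (R - p)) / (R ^ 2 * (R + v)) - 1) := by
      have e1 : (1 - p) * (N * p - (i * p + v)) = p * (R + v) - (v + p) := by rw [hR]; ring
      rw [e1]
      have hR0 : R ≠ 0 := by linarith
      have hRv0 : R + v ≠ 0 := hMa.ne'
      have e2 : i - (i * p + v) = w - v := by rw [hw]; ring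
      rw [e2]
      have e3 : w = i - i * p := by rw [hw]; ring
      field_simp
      rw [e3]
      ring
    rw [key]
    linarith [h0, h4]

/-- Let `A` count the marked elements in `i` draws without replacement and `B` those in `m` draws
with replacement. Given `A + B = s`, the expectation of `A` is at least its unconditional mean
`i * p`, provided that `s` is at least the mean of `i + m + 1` draws. -/
theorem sum_hypergeometricWeight_mul_binomialMass_nonneg {N n i m s : ℕ} {p : ℝ}
    (hN : i + m + 1 ≤ N) (hn : n ≤ N) (hp : (N : ℝ) * p = n)
    (hs : ((i : ℝ) + m + 1) * p ≤ s) :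
    0 ≤ ∑ a ∈ Finset.range (s + 1),
      hypergeometricWeight N n i a * ((a : ℝ) - i * p) * binomialMass p m (s - a) := by
  have hN' : (i : ℝ) + m + 1 ≤ N := by exact_mod_cast hN
  have hi0 : (0 : ℝ) ≤ i := i.cast_nonneg
  have hm0 : (0 : ℝ) ≤ m := m.cast_nonneg
  have hN0 : (0 : ℝ) < N := by linarith
  have hn' : (n : ℝ) ≤ N := by exact_mod_cast hn
  have hp0 : 0 ≤ p := by
    by_contra! h
    nlinarith [(n.cast_nonneg : (0 : ℝ) ≤ n)]
  have hp1 : p ≤ 1 := by nlinarith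
  have hmass : ∀ k, 0 ≤ binomialMass p m k := binomialMass_nonneg hp0 hp1 m
  have hwt : ∀ a, 0 ≤ hypergeometricWeight N n i a := hypergeometricWeight_nonneg N n i
  rcases le_or_gt ((1 - p) * (m + 1)) 1 with hq | hq
  -- if there are few unmarked elements, no value of the first part in the sum is below its mean
  · refine Finset.sum_nonneg fun a ha => ?_
    have ha' : a ≤ s := Nat.lt_succ_iff.1 (Finset.mem_range.1 ha)
    rcases lt_or_ge m (s - a) with h | h
    · rw [binomialMass_eq_zero h, mul_zero]
    · have h' : (s : ℝ) ≤ a + m := by exact_mod_cast (show s ≤ a + m by omega)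
      refine mul_nonneg (mul_nonneg (hwt a) ?_) (hmass _)
      nlinarith
  have hm1 : (1 : ℝ) ≤ m := by
    have : m ≠ 0 := by rintro rfl; simp at hq; linarith
    exact_mod_cast Nat.one_le_iff_ne_zero.2 this
  rcases hp0.eq_or_lt with rfl | hp0'
  · exact Finset.sum_nonneg fun a _ => mul_nonneg (mul_nonneg (hwt a) (by simp)) (hmass _)
  have hp1' : p < 1 := by
    by_contra! h
    nlinarith
  rcases lt_or_ge (i + m) s with hsm | hsm
  -- if `s > i + m`, the event is impossible, and the terms that do not vanish have `a ≥ i`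
  · refine Finset.sum_nonneg fun a ha => ?_
    rcases lt_or_ge m (s - a) with h | h
    · rw [binomialMass_eq_zero h, mul_zero]
    · have h' : (i : ℝ) ≤ a := by exact_mod_cast (show i ≤ a by omega)
      refine mul_nonneg (mul_nonneg (hwt a) ?_) (hmass _)
      nlinarith
  obtain ⟨C, hC, hdrift⟩ := exists_stein_drift_ge hp0' hp1' hi0 hm1 hN' hq hs
    (by exact_mod_cast hsm)
  rw [hp] at hdrift
  set ω : ℕ → ℝ := fun a => hypergeometricWeight N n i a * binomialMass p m (s - a) with hω
  have hω0 : ∀ a, 0 ≤ ω a := fun a => mul_nonneg (hwt a) (hmass _)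
  set U : ℕ → ℝ := fun a => (1 - p) * (n - a) * (i - a) * (s - a) / (N - n - i + 1 + a) with hU
  -- Detailed balance of the weights `ω` across the edge from `a` to `a + 1`. Both step ratios hold
  -- with equality, but dividing by `N - n - i + 1 + a` is illegitimate at the lower end of the
  -- support, where `ω a = 0` while `ω (a + 1)` may be positive; hence only an inequality.
  have hbal : ∀ a ∈ Finset.range s,
      ω a * U a ≤ ω (a + 1) * (((a + 1 : ℕ) : ℝ) * p * (m - s + ((a + 1 : ℕ) : ℝ))) := by
    intro a ha
    have has : a < s := Finset.mem_range.1 ha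
    obtain ⟨b, rfl⟩ := Nat.exists_eq_add_of_lt has
    have hb1 : a + b + 1 - a = b + 1 := by omega
    have hb2 : a + b + 1 - (a + 1) = b := by omega
    have e1 := hypergeometricWeight_step (show i ≤ N by omega) n a
    have e2 := binomialMass_step p m b
    rcases lt_or_ge (N - i) (n - a) with h | h
    · have h0 : ω a = 0 := by
        simp [hω, hypergeometricWeight, Nat.choose_eq_zero_of_lt h]
      rw [h0, zero_mul]
      rcases lt_or_ge m b with h' | h'
      · simp [hω, hb2, binomialMass_eq_zero h']
      · have : (b : ℝ) ≤ m := by exact_mod_cast h'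
        refine mul_nonneg (hω0 _) (mul_nonneg (by positivity) ?_)
        push_cast; linarith
    · have hM : (0 : ℝ) < N - n - i + 1 + a := by
        have : (n : ℝ) + i ≤ N + a := by exact_mod_cast (show n + i ≤ N + a by omega)
        linarith
      refine le_of_eq ?_
      simp only [hω, hU, hb1, hb2]
      rw [mul_div_assoc', div_eq_iff hM.ne']
      push_cast
      linear_combination (hypergeometricWeight N n i a * ((n : ℝ) - a) * (i - a)) * e2
        - (p * (m - b) * binomialMass p m b) * e1
  -- summing the balance over all edges: the drift has nonpositive mean under `ω`
  have hstein : ∑ a ∈ Finset.range (s + 1), ω a * U a ≤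
      ∑ a ∈ Finset.range (s + 1), ω a * ((a : ℝ) * p * (m - s + a)) := by
    rw [Finset.sum_range_succ, Finset.sum_range_succ']
    have h1 : U s = 0 := by simp [hU]
    rw [h1]
    simpa using Finset.sum_le_sum hbal
  have hsum : ∑ a ∈ Finset.range (s + 1), ω a * (C * (i * p - a)) ≤
      ∑ a ∈ Finset.range (s + 1), ω a * (U a - (a : ℝ) * p * (m - s + a)) := by
    refine Finset.sum_le_sum fun a _ => ?_
    by_cases h : hypergeometricWeight N n i a = 0
    · simp [hω, h]
    refine mul_le_mul_of_nonneg_left ?_ (hω0 a)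
    have hai : a ≤ i := by
      by_contra! h'
      exact h (by simp [hypergeometricWeight, Nat.choose_eq_zero_of_lt h'])
    have hna : n - a ≤ N - i := by
      by_contra! h'
      exact h (by simp [hypergeometricWeight, Nat.choose_eq_zero_of_lt h'])
    refine hdrift a (by exact_mod_cast hai) ?_
    have : (n : ℝ) + i ≤ N + a := by exact_mod_cast (show n + i ≤ N + a by omega)
    linarith
  have hfin : C * ∑ a ∈ Finset.range (s + 1),
      hypergeometricWeight N n i a * ((a : ℝ) - i * p) * binomialMass p m (s - a) =
      -∑ a ∈ Finset.range (s + 1), ω a * (C * (i * p - a)) := by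
    rw [Finset.mul_sum, ← Finset.sum_neg_distrib]
    exact Finset.sum_congr rfl fun a _ => by simp only [hω]; ring
  have hsub : ∑ a ∈ Finset.range (s + 1), ω a * (U a - (a : ℝ) * p * (m - s + a)) =
      ∑ a ∈ Finset.range (s + 1), ω a * U a -
        ∑ a ∈ Finset.range (s + 1), ω a * ((a : ℝ) * p * (m - s + a)) := by
    rw [← Finset.sum_sub_distrib]
    exact Finset.sum_congr rfl fun a _ => mul_sub _ _ _
  refine nonneg_of_mul_nonneg_right ?_ hC
  rw [hfin]
  linarith

/-! ### Replacing draws without replacement by draws with replacement -/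

/-- The probability that a binomial variable is less than `d`. -/
def binomialLower (p : ℝ) (m d : ℕ) : ℝ := ∑ k ∈ Finset.range d, binomialMass p m k

theorem binomialMass_succ_succ (p : ℝ) (m k : ℕ) :
    binomialMass p (m + 1) (k + 1) =
      (1 - p) * binomialMass p m (k + 1) + p * binomialMass p m k := by
  unfold binomialMass
  rw [Nat.choose_succ_succ, Nat.add_sub_add_right]
  rcases lt_or_ge k m with h | h
  · obtain ⟨c, rfl⟩ := Nat.exists_eq_add_of_lt h
    rw [show k + c + 1 - k = c + 1 by omega, show k + c + 1 - (k + 1) = c by omega]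
    push_cast; ring
  · rw [Nat.choose_eq_zero_of_lt (Nat.lt_succ_of_le h)]
    push_cast; ring

theorem binomialLower_succ_succ (p : ℝ) (m d : ℕ) :
    binomialLower p (m + 1) (d + 1) =
      (1 - p) * binomialLower p m (d + 1) + p * binomialLower p m d := by
  induction d with
  | zero => simp [binomialLower, binomialMass, pow_succ']
  | succ d ih =>
    have h : ∀ m d, binomialLower p m (d + 1) = binomialLower p m d + binomialMass p m d :=
      fun m d => Finset.sum_range_succ _ _
    rw [h (m + 1) (d + 1), ih, binomialMass_succ_succ, h m (d + 1), h m d]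
    ring

/-- One more draw: given `a` marked elements among the first `i`, the next one is marked with
probability `(n - a) / (N - i)`. -/
theorem hypergeometricWeight_succ {N i : ℕ} (hi : i < N) (n a : ℕ) :
    ((N : ℝ) - i) * hypergeometricWeight N n (i + 1) (a + 1) =
      ((N : ℝ) - i - (n - (a + 1))) * hypergeometricWeight N n i (a + 1) +
        (n - a) * hypergeometricWeight N n i a := by
  obtain ⟨M, rfl⟩ := Nat.exists_eq_add_of_lt hi
  unfold hypergeometricWeight
  rcases lt_or_ge a n with ha | ha
  · obtain ⟨c, rfl⟩ := Nat.exists_eq_add_of_lt ha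
    rw [if_pos (by omega), if_pos (by omega), if_pos (by omega),
      show i + M + 1 - (i + 1) = M by omega, show i + M + 1 - i = M + 1 by omega,
      show a + c + 1 - (a + 1) = c by omega, show a + c + 1 - a = c + 1 by omega,
      Nat.choose_succ_succ i a]
    have h1 : ((M : ℝ) + 1) * (M.choose c : ℝ) = ((M + 1).choose (c + 1) : ℝ) * (c + 1) := by
      exact_mod_cast Nat.add_one_mul_choose_eq M c
    have h2 := cast_succ_mul_choose_succ (M + 1) c
    push_cast at h2 ⊢
    linear_combination ((i.choose a : ℝ) + (i.choose (a + 1) : ℝ)) * h1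
      + (i.choose (a + 1) : ℝ) * h2
  · rcases ha.eq_or_lt with rfl | ha
    · simp
    · rw [if_neg (by omega), if_neg (by omega), if_neg (by omega)]; simp

theorem hypergeometricWeight_succ_zero {N i : ℕ} (hi : i < N) (n : ℕ) :
    ((N : ℝ) - i) * hypergeometricWeight N n (i + 1) 0 =
      ((N : ℝ) - i - n) * hypergeometricWeight N n i 0 := by
  obtain ⟨M, rfl⟩ := Nat.exists_eq_add_of_lt hi
  unfold hypergeometricWeight
  rw [if_pos (by omega), if_pos (by omega),
    show i + M + 1 - (i + 1) = M by omega, show i + M + 1 - i = M + 1 by omega]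
  cases n with
  | zero => simp
  | succ c =>
    have h1 := cast_succ_mul_choose_succ M c
    have h2 : ((M + 1).choose (c + 1) : ℝ) = M.choose c + M.choose (c + 1) := by
      exact_mod_cast Nat.choose_succ_succ M c
    simp only [Nat.choose_zero_right, Nat.sub_zero]
    rw [h2]
    push_cast
    linear_combination h1

/-- The effect of one more draw on the expectation of a function `ℓ` that vanishes at `d`. -/
theorem sum_hypergeometricWeight_succ {N i : ℕ} (hi : i < N) (n d : ℕ) (ℓ : ℕ → ℝ) (hℓ : ℓ d = 0) :
    ((N : ℝ) - i) * ∑ a ∈ Finset.range d, hypergeometricWeight N n (i + 1) a * ℓ a =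
      ∑ a ∈ Finset.range d, hypergeometricWeight N n i a *
        (((N : ℝ) - i - (n - a)) * ℓ a + (n - a) * ℓ (a + 1)) := by
  cases d with
  | zero => simp
  | succ d =>
    have e : ∑ a ∈ Finset.range (d + 1), hypergeometricWeight N n i a *
        (((N : ℝ) - i - (n - a)) * ℓ a + (n - a) * ℓ (a + 1)) =
        (∑ a ∈ Finset.range (d + 1),
          hypergeometricWeight N n i a * (((N : ℝ) - i - (n - a)) * ℓ a)) +
        ∑ a ∈ Finset.range (d + 1), hypergeometricWeight N n i a * ((n - a) * ℓ (a + 1)) := by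
      rw [← Finset.sum_add_distrib]
      exact Finset.sum_congr rfl fun a _ => by ring
    rw [e, Finset.sum_range_succ', Finset.sum_range_succ' (n := d),
      Finset.sum_range_succ (n := d), hℓ, mul_add, Finset.mul_sum]
    have h0 := hypergeometricWeight_succ_zero hi n
    have h1 : ∑ a ∈ Finset.range d,
        ((N : ℝ) - i) * (hypergeometricWeight N n (i + 1) (a + 1) * ℓ (a + 1)) =
        (∑ a ∈ Finset.range d, hypergeometricWeight N n i (a + 1) *
          (((N : ℝ) - i - (n - ((a + 1 : ℕ) : ℝ))) * ℓ (a + 1))) +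
        ∑ a ∈ Finset.range d, hypergeometricWeight N n i a * ((n - a) * ℓ (a + 1)) := by
      rw [← Finset.sum_add_distrib]
      refine Finset.sum_congr rfl fun a _ => ?_
      push_cast
      linear_combination ℓ (a + 1) * hypergeometricWeight_succ hi n a
    rw [h1]
    push_cast
    linear_combination ℓ 0 * h0

/-- Drawing `i` elements without replacement and `m` with replacement, the weight of the event that
fewer than `d` marked elements are seen. -/
def hybridLower (N n : ℕ) (p : ℝ) (d i m : ℕ) : ℝ :=
  ∑ a ∈ Finset.range d, hypergeometricWeight N n i a * binomialLower p m (d - a)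

/-- Turning one draw with replacement into one without can only raise the lower tail: the difference
is a multiple of the sum in `sum_hypergeometricWeight_mul_binomialMass_nonneg`. -/
theorem hybridLower_le {N n i m s : ℕ} {p : ℝ}
    (hN : i + m + 1 ≤ N) (hn : n ≤ N) (hp : (N : ℝ) * p = n)
    (hs : ((i : ℝ) + m + 1) * p ≤ s) :
    hybridLower N n p (s + 1) i (m + 1) ≤ hybridLower N n p (s + 1) (i + 1) m := by
  have hN' : (i : ℝ) + m + 1 ≤ N := by exact_mod_cast hN
  have hNi : (0 : ℝ) < N - i := by linarith [(m.cast_nonneg : (0 : ℝ) ≤ m)]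
  have key := sum_hypergeometricWeight_mul_binomialMass_nonneg hN hn hp hs
  have h := sum_hypergeometricWeight_succ (show i < N by omega) n (s + 1)
    (fun a => binomialLower p m (s + 1 - a)) (by simp [binomialLower])
  refine le_of_mul_le_mul_left ?_ hNi
  unfold hybridLower
  rw [h, Finset.mul_sum, ← sub_nonneg, ← Finset.sum_sub_distrib]
  refine key.trans_eq (Finset.sum_congr rfl fun a ha => ?_)
  obtain ⟨c, rfl⟩ := Nat.exists_eq_add_of_le (Nat.lt_succ_iff.1 (Finset.mem_range.1 ha))
  rw [show a + c + 1 - a = c + 1 by omega, show a + c + 1 - (a + 1) = c by omega,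
    show a + c - a = c by omega, binomialLower_succ_succ,
    show binomialLower p m (c + 1) = binomialLower p m c + binomialMass p m c from
      Finset.sum_range_succ _ _]
  linear_combination (-hypergeometricWeight N n i a * binomialMass p m c) * hp

theorem hybridLower_zero_le {N n K s : ℕ} {p : ℝ} (hK : K ≤ N) (hn : n ≤ N)
    (hp : (N : ℝ) * p = n) (hs : (K : ℝ) * p ≤ s) :
    hybridLower N n p (s + 1) 0 K ≤ hybridLower N n p (s + 1) K 0 := by
  have h : ∀ i m, i + m = K →
      hybridLower N n p (s + 1) 0 K ≤ hybridLower N n p (s + 1) i m := by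
    intro i
    induction i with
    | zero => rintro m h; rw [← h, zero_add]
    | succ i ih =>
      intro m h
      refine (ih (m + 1) (by omega)).trans (hybridLower_le (by omega) hn hp ?_)
      refine le_trans (le_of_eq ?_) hs
      rw [← h]; push_cast; ring
  exact h K 0 (add_zero K)

/-- The weight of seeing fewer than `s + 1` marked elements is at least as large without
replacement as with it, once `s` is at least the mean. -/
theorem choose_mul_binomialLower_le {N n K s : ℕ} {p : ℝ} (hK : K ≤ N) (hn : n ≤ N)
    (hp : (N : ℝ) * p = n) (hs : (K : ℝ) * p ≤ s) :
    (N.choose n : ℝ) * binomialLower p K (s + 1) ≤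
      ∑ a ∈ Finset.range (s + 1), hypergeometricWeight N n K a := by
  have h := hybridLower_zero_le hK hn hp hs
  have h1 : hybridLower N n p (s + 1) 0 K = (N.choose n : ℝ) * binomialLower p K (s + 1) := by
    unfold hybridLower
    rw [Finset.sum_range_succ', Finset.sum_eq_zero]
    · simp [hypergeometricWeight]
    · intro a _
      simp [hypergeometricWeight]
  have h2 : hybridLower N n p (s + 1) K 0 =
      ∑ a ∈ Finset.range (s + 1), hypergeometricWeight N n K a := by
    unfold hybridLower
    refine Finset.sum_congr rfl fun a ha => ?_
    obtain ⟨c, hc⟩ := Nat.exists_eq_add_of_lt (Finset.mem_range.1 ha)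
    rw [show s + 1 - a = c + 1 by omega, binomialLower, Finset.sum_range_succ',
      Finset.sum_eq_zero]
    · simp [binomialMass]
    · intro k _
      exact binomialMass_eq_zero (Nat.succ_pos k)
  rwa [h1, h2] at h

/-! ### The Chernoff bound for the binomial tail -/

theorem binomialLower_add_tail (p : ℝ) (K D : ℕ) (hD : D ≤ K) :
    binomialLower p K D + ∑ k ∈ Finset.Ico D (K + 1), binomialMass p K k = 1 := by
  rw [binomialLower, Finset.range_eq_Ico, Finset.sum_Ico_consecutive _ (Nat.zero_le _) (by omega),
    ← Finset.range_eq_Ico]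
  have h := add_pow p (1 - p) K
  rw [add_sub_cancel, one_pow] at h
  rw [h]
  exact Finset.sum_congr rfl fun k _ => by unfold binomialMass; ring

/-- Chernoff's bound for the binomial distribution, in a form that avoids division, so that `x = 1`
is not exceptional: on the tail, the likelihood ratio of the parameters `p ≤ x` is at most its value
at `D`. -/
theorem binomial_tail_mul_le {p x : ℝ} (hp0 : 0 ≤ p) (hpx : p ≤ x) (hx1 : x ≤ 1) {K D : ℕ}
    (hD : D ≤ K) :
    (1 - binomialLower p K D) * (x ^ D * (1 - x) ^ (K - D)) ≤ p ^ D * (1 - p) ^ (K - D) := by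
  have hx0 : 0 ≤ x := hp0.trans hpx
  have hy : 0 ≤ 1 - x := by linarith
  have hq : 0 ≤ 1 - p := by linarith
  have h0 : 1 - binomialLower p K D = ∑ k ∈ Finset.Ico D (K + 1), binomialMass p K k := by
    rw [← binomialLower_add_tail p K D hD, add_sub_cancel_left]
  rw [h0, Finset.sum_mul]
  have h1 : ∑ k ∈ Finset.Ico D (K + 1), binomialMass x K k ≤ 1 := by
    have := Finset.sum_nonneg (s := Finset.range D) fun k _ => binomialMass_nonneg hx0 hx1 K k
    rw [← binomialLower_add_tail x K D hD, binomialLower]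
    linarith
  have h2 : 0 ≤ p ^ D * (1 - p) ^ (K - D) := by positivity
  refine le_trans ?_ (mul_le_of_le_one_right h2 h1)
  rw [Finset.mul_sum]
  refine Finset.sum_le_sum fun k hk => ?_
  rw [Finset.mem_Ico] at hk
  obtain ⟨b, rfl⟩ := Nat.exists_eq_add_of_le hk.1
  obtain ⟨c, rfl⟩ := Nat.exists_eq_add_of_le (Nat.lt_succ_iff.1 hk.2)
  unfold binomialMass
  rw [show D + b + c - (D + b) = c by omega, show D + b + c - D = b + c by omega]
  have h3 : (p * (1 - x)) ^ b ≤ (x * (1 - p)) ^ b :=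
    pow_le_pow_left₀ (mul_nonneg hp0 hy) (by nlinarith) b
  have h4 : 0 ≤ ((D + b + c).choose (D + b) : ℝ) * (p ^ D * x ^ D * (1 - p) ^ c * (1 - x) ^ c) := by
    positivity
  have h5 := mul_le_mul_of_nonneg_left h3 h4
  rw [mul_pow, mul_pow] at h5
  refine le_of_eq_of_le ?_ (h5.trans_eq ?_) <;> ring

theorem one_sub_binomialLower_le_exp {p : ℝ} (hp0 : 0 ≤ p) (hp1 : p < 1) {K D : ℕ} (hD0 : 0 < D)
    (hD : D ≤ K) (h : (K : ℝ) * p ≤ D) :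
    ENNReal.ofReal (1 - binomialLower p K D) ≤
      EReal.exp (-(((K : ℝ) : EReal) * bernoulliKL ((D : ℝ) / (K : ℝ)) p)) := by
  have hK : (0 : ℝ) < K := by exact_mod_cast hD0.trans_le hD
  have hDK : (D : ℝ) ≤ K := by exact_mod_cast hD
  obtain ⟨x, hx⟩ : ∃ x, x = (D : ℝ) / K := ⟨_, rfl⟩
  have hKx : (K : ℝ) * x = D := by rw [hx]; field_simp
  have hx0 : 0 < x := by rw [hx]; positivity
  have hx1 : x ≤ 1 := by rw [hx]; exact div_le_one_of_le₀ hDK hK.le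
  have hpx : p ≤ x := by rw [hx, le_div_iff₀ hK]; linarith
  have hyD : 0 < (1 - x) ^ (K - D) := by
    rcases hD.eq_or_lt with rfl | hlt
    · simp
    · have : (D : ℝ) < K := by exact_mod_cast hlt
      exact pow_pos (by nlinarith) _
  have hxD : 0 < x ^ D := pow_pos hx0 D
  have key : 1 - binomialLower p K D ≤ (p ^ D * (1 - p) ^ (K - D)) / (x ^ D * (1 - x) ^ (K - D)) := by
    rw [le_div_iff₀ (mul_pos hxD hyD)]
    exact binomial_tail_mul_le hp0 hpx hx1 hD
  rw [← hx]
  rcases hp0.eq_or_lt with rfl | hp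
  -- for `p = 0` the divergence is `⊤` and the bound reads `0`
  · have : 1 - binomialLower 0 K D ≤ 0 := by simpa [hD0.ne'] using key
    rw [ENNReal.ofReal_of_nonpos this]
    exact zero_le
  · rw [bernoulliKL, if_neg (by rintro (h | h) <;> linarith [h.1]), ← EReal.coe_mul,
      ← EReal.coe_neg, EReal.exp_coe]
    refine ENNReal.ofReal_le_ofReal (key.trans_eq ?_)
    have e : -((K : ℝ) * (x * Real.log (x / p) + (1 - x) * Real.log ((1 - x) / (1 - p)))) =
        (D : ℝ) * Real.log (p / x) + ((K - D : ℕ) : ℝ) * -Real.log ((1 - x) / (1 - p)) := by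
      rw [Nat.cast_sub hD, ← hKx, ← inv_div x p, Real.log_inv]
      ring
    rw [e, Real.exp_add, Real.exp_nat_mul, Real.exp_nat_mul, Real.exp_log (by positivity)]
    rcases hD.eq_or_lt with rfl | hlt
    · simp [div_pow]
    · have hlt' : (D : ℝ) < K := by exact_mod_cast hlt
      have hy : 0 < 1 - x := by nlinarith
      rw [← Real.log_inv, inv_div, Real.exp_log (div_pos (by linarith) hy), div_pow, div_pow,
        div_mul_div_comm]

/-! ### The binomial tail as an incomplete beta function -/

/-- The derivatives of the individual masses telescope. -/
theorem hasDerivAt_binomialLower {K s : ℕ} (hs : s + 1 ≤ K) (x : ℝ) :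
    HasDerivAt (fun p => binomialLower p K (s + 1))
      (-(((s : ℝ) + 1) * (K.choose (s + 1) : ℝ)) * (x ^ s * (1 - x) ^ (K - (s + 1)))) x := by
  have hsub : HasDerivAt (fun p : ℝ => 1 - p) (-1) x := by
    simpa using (hasDerivAt_id x).const_sub 1
  induction s with
  | zero =>
    have h := hsub.pow K
    have e : (fun p : ℝ => binomialLower p K (0 + 1)) = (fun p : ℝ => 1 - p) ^ K := by
      ext y; simp [binomialLower, binomialMass]
    rw [e]
    refine h.congr_deriv ?_
    simp
  | succ s ih =>
    have h1 := ih (by omega)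
    have h2 : HasDerivAt (fun p => binomialMass p K (s + 1)) _ x :=
      ((hasDerivAt_pow (s + 1) x).const_mul (K.choose (s + 1) : ℝ)).mul (hsub.pow (K - (s + 1)))
    have h3 := h1.add h2
    have e : (fun p => binomialLower p K (s + 1 + 1)) =
        (fun p => binomialLower p K (s + 1)) + fun p => binomialMass p K (s + 1) := by
      ext p; exact Finset.sum_range_succ _ _
    rw [e]
    refine h3.congr_deriv ?_
    obtain ⟨c, rfl⟩ := Nat.exists_eq_add_of_le hs
    have h4 := cast_succ_mul_choose_succ (s + 1 + 1 + c) (s + 1)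
    rw [show s + 1 + 1 + c - (s + 1 + 1) = c by omega,
      show s + 1 + 1 + c - (s + 1) = c + 1 by omega]
    push_cast at h4 ⊢
    linear_combination (x ^ (s + 1) * (1 - x) ^ c) * h4

theorem binomialLower_at_zero (K s : ℕ) : binomialLower 0 K (s + 1) = 1 := by
  rw [binomialLower, Finset.sum_range_succ', Finset.sum_eq_zero]
  · simp [binomialMass]
  · intro k _; simp [binomialMass]

theorem binomialLower_at_one {K d : ℕ} (hd : d ≤ K) : binomialLower 1 K d = 0 := by
  refine Finset.sum_eq_zero fun k hk => ?_
  have : K - k ≠ 0 := by have := Finset.mem_range.1 hk; omega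
  simp [binomialMass, this]

/-- The regularized incomplete beta function at integer parameters is a binomial tail: both sides
have the same derivative in `x`, up to the normalizing constant. -/
theorem regIncompleteBeta_eq {K s : ℕ} (hs : s + 1 ≤ K) (x : ℝ) :
    regIncompleteBeta x ((s + 1 : ℕ) : ℝ) ((K : ℝ) - ((s + 1 : ℕ) : ℝ) + 1) =
      1 - binomialLower x K (s + 1) := by
  obtain ⟨c, hc⟩ : ∃ c : ℝ, c = ((s : ℝ) + 1) * (K.choose (s + 1) : ℝ) := ⟨_, rfl⟩
  have hc0 : c ≠ 0 := by
    have := Nat.choose_pos hs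
    rw [hc]; positivity
  have hint : ∀ y : ℝ, (∫ t in (0 : ℝ)..y, t ^ (((s + 1 : ℕ) : ℝ) - 1) *
      (1 - t) ^ ((K : ℝ) - ((s + 1 : ℕ) : ℝ) + 1 - 1)) = (1 - binomialLower y K (s + 1)) / c := by
    intro y
    have e : ∀ t : ℝ, t ^ (((s + 1 : ℕ) : ℝ) - 1) *
        (1 - t) ^ ((K : ℝ) - ((s + 1 : ℕ) : ℝ) + 1 - 1) = t ^ s * (1 - t) ^ (K - (s + 1)) := by
      intro t
      rw [add_sub_cancel_right, ← Nat.cast_sub hs, Real.rpow_natCast, Nat.cast_succ,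
        add_sub_cancel_right, Real.rpow_natCast]
    simp only [e]
    have h := intervalIntegral.integral_eq_sub_of_hasDerivAt
      (fun t _ => hasDerivAt_binomialLower hs t)
      (Continuous.intervalIntegrable (by fun_prop) 0 y)
    rw [intervalIntegral.integral_const_mul, binomialLower_at_zero, ← hc] at h
    rw [eq_div_iff hc0]
    linarith
  rw [regIncompleteBeta, hint, hint, binomialLower_at_one hs]
  field_simp
  ring

/-! ### Tails of the hypergeometric and binomial measures -/

theorem binomial_real_ge (K D : ℕ) (p : unitInterval) :
    (binomial K p).real {k : ℕ | D ≤ k} = 1 - binomialLower p K D := by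
  have h : {k : ℕ | D ≤ k} = ((Finset.range D : Finset ℕ) : Set ℕ)ᶜ := by ext; simp
  rw [h, probReal_compl_eq_one_sub (Finset.measurableSet _), ← sum_measureReal_singleton]
  simp only [binomial_real_singleton, binomialLower, binomialMass]

theorem hypergeometricPMF_toReal (N K n : ℕ) (hK : K ≤ N) (hn : n ≤ N) (k : ℕ) :
    (hypergeometricPMF N K n hK hn k).toReal =
      hypergeometricWeight N n K k / (N.choose n : ℝ) := by
  change (hypergeometricMass N K n k).toReal = _
  unfold hypergeometricMass hypergeometricWeight
  split_ifs <;> simp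

theorem hypergeometricPMF_real_ge (N K n D : ℕ) (hK : K ≤ N) (hn : n ≤ N) :
    (hypergeometricPMF N K n hK hn).toMeasure.real {k : ℕ | D ≤ k} =
      1 - (∑ a ∈ Finset.range D, hypergeometricWeight N n K a) / (N.choose n : ℝ) := by
  have h : {k : ℕ | D ≤ k} = ((Finset.range D : Finset ℕ) : Set ℕ)ᶜ := by ext; simp
  rw [h, probReal_compl_eq_one_sub (Finset.measurableSet _), ← sum_measureReal_singleton,
    Finset.sum_div]
  congr 1
  refine Finset.sum_congr rfl fun k _ => ?_
  rw [measureReal_def, PMF.toMeasure_apply_singleton _ _ (measurableSet_singleton k),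
    hypergeometricPMF_toReal]

theorem hypergeometricPMF_ge_eq_zero {N K n D : ℕ} (hK : K ≤ N) (hn : n ≤ N) (hD : K < D) :
    (hypergeometricPMF N K n hK hn).toMeasure {k : ℕ | D ≤ k} = 0 := by
  rw [PMF.toMeasure_apply_eq_zero_iff _ MeasurableSet.of_discrete, Set.disjoint_left]
  intro k hk hk'
  refine (PMF.mem_support_iff _ _).1 hk ?_
  have hk'' : K < k := lt_of_lt_of_le hD hk'
  change hypergeometricMass N K n k = 0
  simp [hypergeometricMass, Nat.choose_eq_zero_of_lt hk'']

theorem hypergeometricPMF_real_ge_le {N K n s : ℕ} {p : ℝ} (hK : K ≤ N) (hn : n ≤ N)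
    (hp : (N : ℝ) * p = n) (hs : (K : ℝ) * p ≤ s) :
    (hypergeometricPMF N K n hK hn).toMeasure.real {k : ℕ | s + 1 ≤ k} ≤
      1 - binomialLower p K (s + 1) := by
  have hc : (0 : ℝ) < N.choose n := by exact_mod_cast Nat.choose_pos hn
  rw [hypergeometricPMF_real_ge]
  refine sub_le_sub_left ?_ 1
  rw [le_div_iff₀ hc, mul_comm]
  exact choose_mul_binomialLower_le hK hn hp hs

theorem mainTheorem1 {Ω : Type*} [MeasurableSpace Ω] (P : Measure Ω) [IsProbabilityMeasure P]
    (N K n : ℕ) (hN : 0 < N) (hK : K ≤ N) (hn : n ≤ N)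
    (X : Ω → ℕ) (hX : HasLaw X (hypergeometricPMF N K n hK hn).toMeasure P)
    (d : ℤ) (hd : (n : ℝ) * (K : ℝ) / (N : ℝ) + 1 ≤ (d : ℝ)) :
    (d ≤ (K : ℤ) →
      P {ω | d ≤ (X ω : ℤ)} ≤
          EReal.exp (-(((K : ℝ) : EReal) * bernoulliKL ((d : ℝ) / (K : ℝ)) ((n : ℝ) / (N : ℝ)))) ∧
      P.real {ω | d ≤ (X ω : ℤ)} ≤
          regIncompleteBeta ((n : ℝ) / (N : ℝ)) (d : ℝ) ((K : ℝ) - (d : ℝ) + 1) ∧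
      regIncompleteBeta ((n : ℝ) / (N : ℝ)) (d : ℝ) ((K : ℝ) - (d : ℝ) + 1) =
        (binomial K ⟨(n : ℝ) / (N : ℝ), unitInterval.div_mem (Nat.cast_nonneg n)
          (Nat.cast_nonneg N) (Nat.cast_le.2 hn)⟩).real {k : ℕ | d ≤ (k : ℤ)}) ∧
    ((K : ℤ) < d → P {ω | d ≤ (X ω : ℤ)} = 0) := by
  have hN' : (0 : ℝ) < N := by exact_mod_cast hN
  obtain ⟨p, hp⟩ : ∃ p, p = (n : ℝ) / N := ⟨_, rfl⟩
  have hNp : (N : ℝ) * p = n := by rw [hp]; field_simp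
  have hp0 : 0 ≤ p := by rw [hp]; positivity
  have hKp : (n : ℝ) * K / N = K * p := by rw [hp]; ring
  rw [hKp] at hd
  have hKp0 : 0 ≤ (K : ℝ) * p := by positivity
  have hd1 : 1 ≤ d := by
    have : (1 : ℝ) ≤ d := by linarith
    exact_mod_cast this
  obtain ⟨s, rfl⟩ : ∃ s : ℕ, d = ((s + 1 : ℕ) : ℤ) := ⟨(d - 1).toNat, by omega⟩
  simp only [Int.cast_natCast, Nat.cast_le, Nat.cast_lt] at hd ⊢
  have hs : (K : ℝ) * p ≤ s := by push_cast at hd; linarith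
  have hPX : P {ω | s + 1 ≤ X ω} =
      (hypergeometricPMF N K n hK hn).toMeasure {k | s + 1 ≤ k} :=
    hX.measure_eq (p := fun k => s + 1 ≤ k) MeasurableSet.of_discrete
  have hPr : P.real {ω | s + 1 ≤ X ω} ≤ 1 - binomialLower p K (s + 1) := by
    rw [measureReal_def, hPX]
    exact hypergeometricPMF_real_ge_le hK hn hNp hs
  refine ⟨fun hdK => ⟨?_, ?_, ?_⟩, fun hKd => ?_⟩
  -- `p = 1` would force `d > K`
  · have hp1 : p < 1 := by
      by_contra! h
      have h1 : ((s + 1 : ℕ) : ℝ) ≤ K := by exact_mod_cast hdK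
      push_cast at h1
      nlinarith [(K.cast_nonneg : (0 : ℝ) ≤ K)]
    rw [← hp, ← ofReal_measureReal]
    exact (ENNReal.ofReal_le_ofReal hPr).trans
      (one_sub_binomialLower_le_exp hp0 hp1 s.succ_pos hdK (by push_cast; linarith))
  · rw [← hp, regIncompleteBeta_eq hdK]
    exact hPr
  · rw [regIncompleteBeta_eq hdK, binomial_real_ge]
  · rw [hPX]
    exact hypergeometricPMF_ge_eq_zero hK hn hKd
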